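/- **Setting.** Let $d\ge 1$ and let $(\mathcal F_t)_{t\ge 0}$ be a filtration on a probability space. Let $\lambda_{\max}\in(0,\infty]$ and let $\psi:[0,\lambda_{\max})\to[0,\infty)$ be CGF-like, i.e. twice continuously differentiable and strictly convex with $\psi(0)=\psi'(0)=0$ and $\psi''(0)>0$. Assume that $\psi$ is super-Gaussian, i.e. $\psi(\lambda)/\lambda^2$ is nondecreasing on $(0,\lambda_{\max})$, and that $\sup_{\lambda}\psi'(\lambda)=\infty$. Let $\psi^*(u)=\sup_{\lambda\in[0,\lambda_{\max})}(u\lambda-\psi(\lambda))$ and let $(\psi^*)^{-1}$ be the inverse of $\psi^*:[0,\infty)\to[0,\infty)$. *Sub-$\psi$ processes.* Adapted processes $(S_t)_{t\ge0}$ in $\mathbb R^d$ and $(V_t)_{t\ge0}$ in the positive semidefinite $d\times d$ matrices are such that $(S_t)$ is sub-$\psi$ with variance proxy $(V_t)$ if for every unit vector $\nu$ and every $\lambda\in[0,\lambda_{\max})$ there is a nonnegative supermartingale $(L_t)_{t\ge 0}$ with $\mathbb E[L_0]\le 1$ and, almost surely, $\exp\{\lambda\langle\nu,S_t\rangle-\psi(\lambda)\langle\nu,V_t\nu\rangle\}\le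 L_t$ for all $t\ge0$. *Online linear regression.* Let $\theta^*\in\mathbb R^d$ be fixed, let $(X_t)_{t\ge1}$ be $\mathbb R^d$-valued with $X_t$ measurable with respect to $\mathcal F_{t-1}$, let $(\epsilon_t)_{t\ge1}$ be real-valued and adapted, and let $Y_t=\langle X_t,\theta^*\rangle+\epsilon_t$. Assume that $S_t:=\sum_{s=1}^t\epsilon_sX_s$ is sub-$\psi$ with variance proxy $V_t:=\sum_{s=1}^tX_sX_s^\top$. Let $\mathbf X_t\in\mathbb R^{t\times d}$ have rows $X_1,\dots,X_t$ and let $\mathbf Y_t\in\mathbb R^t$ have entries $Y_1,\dots,Y_t$, so that $V_t=\mathbf X_t^\top\mathbf X_t$. *Boundary.* Let $\alpha>1$, $\beta>1$, $\rho>0$, $\epsilon\in(0,1)$ and $\delta\in(0,1)$. Let $h:[0,\infty)\to(0,\infty)$ be nondecreasing with $\sum_{k=0}^\infty h(k)^{-1}\le 1$. For a symmetric matrix $A$ let $\gamma_{\max}(A)$ and $\gamma_{\min}(A)$ be its largest and smallest eigenvalues, let $\kappa(A)=\gamma_{\max}(A)/\gamma_{\min}(A)$, and let $A\vee\rho I_d$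 be the matrix obtained from $A$ by keeping the eigenvectors and replacing each eigenvalue $\gamma$ by $\max\{\gamma,\rho\}$. Let $N_{d-1}(r)$ be the least number of points of the unit sphere of $\mathbb R^d$ whose closed Euclidean $r$-balls cover that sphere. For positive semidefinite $A$ put $$L_\rho(A)=\log h\Big(\log_\alpha\tfrac{\gamma_{\max}(A\vee\rho I_d)}{\rho}\Big)+\log\Big(\tfrac1\delta\cdot\tfrac{1}{1-\beta^{-1}}\Big)+\log\Big(\beta\sqrt{\kappa(A\vee\rho I_d)}\;N_{d-1}\Big(\tfrac{\epsilon}{\beta\sqrt{\kappa(A\vee\rho I_d)}}\Big)\Big).$$ **Corollary 5.2.** Let $\tilde\theta_t:=(\mathbf X_t^\top\mathbf X_t+\rho I_d)^{-1}\mathbf X_t^\top\mathbf Y_t$ be the ridge estimates. With probability at least $1-\delta$, simultaneously for all $t\ge1$, $$\big\|(V_t+\rho I_d)^{1/2}(\tilde\theta_t-\theta^*)\big\|<\frac{\sqrt{\gamma_{\min}(V_t+\rho I_d)}}{1-\epsilon}\,(\psi^*)^{-1}\Big(\frac{\alpha}{\gamma_{\min}(V_t+\rho I_d)}\,L_\rho(V_t+\rho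 I_d)\Big)+\sqrt\rho\,\|\theta^*\|.$$ -/

import Mathlib

open MeasureTheory

noncomputable section

/-! ### CGF-like functions -/

/-- The half-open interval `[0, lmax)`, where the right end point may be infinite. -/
def cgfDomain (lmax : EReal) : Set ℝ := {x : ℝ | 0 ≤ x ∧ (x : EReal) < lmax}

/-- `ψ : [0, lmax) → [0, ∞)` is CGF-like: twice continuously differentiable, strictly convex,
`ψ(0) = ψ'(0) = 0` and `ψ''(0) > 0` (derivatives at `0` are one-sided). Only the values of `ψ` on
`[0, lmax)` matter. -/
structure IsCGFLike (ψ : ℝ → ℝ) (lmax : EReal) : Prop where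
  lmax_pos : 0 < lmax
  nonneg : ∀ x ∈ cgfDomain lmax, 0 ≤ ψ x
  contDiffOn : ContDiffOn ℝ 2 ψ (cgfDomain lmax)
  strictConvexOn : StrictConvexOn ℝ (cgfDomain lmax) ψ
  map_zero : ψ 0 = 0
  deriv_zero : derivWithin ψ (cgfDomain lmax) 0 = 0
  second_deriv_zero_pos : 0 < iteratedDerivWithin 2 ψ (cgfDomain lmax) 0

/-- `ψ` is super-Gaussian: `ψ(x) / x ^ 2` is a nondecreasing function of `x ∈ (0, lmax)`. -/
def IsSuperGaussian (ψ : ℝ → ℝ) (lmax : EReal) : Prop :=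
  MonotoneOn (fun x => ψ x / x ^ 2) {x : ℝ | 0 < x ∧ (x : EReal) < lmax}

/-- `sup ψ' = ∞` on `[0, lmax)`. -/
def HasUnboundedSlope (ψ : ℝ → ℝ) (lmax : EReal) : Prop :=
  ¬ BddAbove (derivWithin ψ (cgfDomain lmax) '' cgfDomain lmax)

/-- The convex conjugate `ψ*(u) = sup_{x ∈ [0, lmax)} (u x - ψ(x))`. For CGF-like `ψ` with
unbounded slope and `u ≥ 0` the supremum is over a nonempty set that is bounded above. -/
def cgfConj (ψ : ℝ → ℝ) (lmax : EReal) (u : ℝ) : ℝ :=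
  sSup ((fun x => u * x - ψ x) '' cgfDomain lmax)

/-- The inverse `(ψ*)⁻¹` of the conjugate `ψ* : [0, ∞) → [0, ∞)`. -/
def cgfConjInv (ψ : ℝ → ℝ) (lmax : EReal) : ℝ → ℝ :=
  Function.invFunOn (cgfConj ψ lmax) (Set.Ici 0)

/-! ### Sub-`ψ` processes -/

/-- The real-valued process `S` is sub-`ψ` with variance proxy `V`: for every `l ∈ [0, lmax)` the
process `exp (l S_t - ψ(l) V_t)` is almost surely bounded above by a nonnegative supermartingale
`L` with `E[L_0] ≤ 1`. -/
structure IsSubPsi {Ω : Type*} {m : MeasurableSpace Ω} (μ : Measure Ω) (ℱ : Filtration ℕ m)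
    (ψ : ℝ → ℝ) (lmax : EReal) (S V : ℕ → Ω → ℝ) : Prop where
  adapted_process : ∀ t, Measurable[ℱ t] (S t)
  adapted_proxy : ∀ t, Measurable[ℱ t] (V t)
  proxy_nonneg : ∀ t ω, 0 ≤ V t ω
  dominated : ∀ l ∈ cgfDomain lmax, ∃ L : ℕ → Ω → ℝ,
    Supermartingale L ℱ μ ∧ (∀ t, 0 ≤ᵐ[μ] L t) ∧ ∫ ω, L 0 ω ∂μ ≤ 1 ∧
      ∀ t, ∀ᵐ ω ∂μ, Real.exp (l * S t ω - ψ l * V t ω) ≤ L t ω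

/-- The `ℝ^d`-valued process `S` is sub-`ψ` with (positive semidefinite) matrix variance proxy `V`:
for every unit vector `ν`, the process `⟨ν, S_t⟩` is sub-`ψ` with variance proxy `⟨ν, V_t ν⟩`.
(Adaptedness of `S` and `V` is that of all these projections.) -/
structure IsVectorSubPsi {Ω : Type*} {m : MeasurableSpace Ω} {d : ℕ} (μ : Measure Ω)
    (ℱ : Filtration ℕ m) (ψ : ℝ → ℝ) (lmax : EReal)
    (S : ℕ → Ω → EuclideanSpace ℝ (Fin d)) (V : ℕ → Ω → Matrix (Fin d) (Fin d) ℝ) : Prop where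
  posSemidef : ∀ t ω, (V t ω).PosSemidef
  projection : ∀ ν : EuclideanSpace ℝ (Fin d), ‖ν‖ = 1 →
    IsSubPsi μ ℱ ψ lmax (fun t ω => inner ℝ ν (S t ω))
      (fun t ω => inner ℝ ν (Matrix.toEuclideanLin (V t ω) ν))

/-! ### Spectral quantities of symmetric matrices -/

/-- The largest eigenvalue of a symmetric real matrix. -/
def gammaMax {d : ℕ} (A : Matrix (Fin d) (Fin d) ℝ) : ℝ := sSup (spectrum ℝ A)

/-- The smallest eigenvalue of a symmetric real matrix. -/
def gammaMin {d : ℕ} (A : Matrix (Fin d) (Fin d) ℝ) : ℝ := sInf (spectrum ℝ A)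

/-- The condition number; it is only used for positive definite matrices. -/
def conditionNumber {d : ℕ} (A : Matrix (Fin d) (Fin d) ℝ) : ℝ := gammaMax A / gammaMin A

/-- `A ∨ ρ I` for symmetric `A`: same eigenvectors, each eigenvalue `γ` replaced by `max γ ρ`. -/
def eigenvalueMax {d : ℕ} (A : Matrix (Fin d) (Fin d) ℝ) (ρ : ℝ) : Matrix (Fin d) (Fin d) ℝ :=
  cfc (fun x : ℝ => max x ρ) A

/-- The positive semidefinite square root `A ^ (1/2)`: same eigenvectors, each eigenvalue `γ`
replaced by `√γ`. -/
def matrixSqrt {d : ℕ} (A : Matrix (Fin d) (Fin d) ℝ) : Matrix (Fin d) (Fin d) ℝ :=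
  cfc Real.sqrt A

/-! ### The boundary -/

/-- The proper `r`-covering number of the unit sphere of `ℝ^d` in the Euclidean distance: the
least number of points of the sphere whose closed `r`-balls cover it (finite for `r > 0`). -/
def sphereCoveringNumber (d : ℕ) (r : ℝ) : ℕ :=
  (Metric.coveringNumber r.toNNReal (Metric.sphere (0 : EuclideanSpace ℝ (Fin d)) 1)).toNat

/-- The function `L_ρ`. -/
def logBoundary {d : ℕ} (α β ρ ε δ : ℝ) (h : ℝ → ℝ) (A : Matrix (Fin d) (Fin d) ℝ) : ℝ :=
  Real.log (h (Real.logb α (gammaMax (eigenvalueMax A ρ) / ρ)))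
    + Real.log (1 / δ * (1 / (1 - β⁻¹)))
    + Real.log (β * √(conditionNumber (eigenvalueMax A ρ))
        * sphereCoveringNumber d (ε / (β * √(conditionNumber (eigenvalueMax A ρ)))))

/-! ### Online linear regression -/

/-- The residual process `S_t = ∑_{s=1}^t ξ_s X_s`. -/
def residualProcess {Ω : Type*} {d : ℕ} (X : ℕ → Ω → EuclideanSpace ℝ (Fin d))
    (ξ : ℕ → Ω → ℝ) (t : ℕ) (ω : Ω) : EuclideanSpace ℝ (Fin d) :=
  ∑ s ∈ Finset.Icc 1 t, ξ s ω • X s ω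

/-- The covariance process `V_t = ∑_{s=1}^t X_s X_sᵀ`. -/
def covarianceProcess {Ω : Type*} {d : ℕ} (X : ℕ → Ω → EuclideanSpace ℝ (Fin d))
    (t : ℕ) (ω : Ω) : Matrix (Fin d) (Fin d) ℝ :=
  ∑ s ∈ Finset.Icc 1 t, Matrix.vecMulVec (X s ω).ofLp (X s ω).ofLp

/-- The `t × d` matrix with rows `X_1, …, X_t`. -/
def designMatrix {Ω : Type*} {d : ℕ} (X : ℕ → Ω → EuclideanSpace ℝ (Fin d))
    (t : ℕ) (ω : Ω) : Matrix (Fin t) (Fin d) ℝ :=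
  Matrix.of fun i j => X (i + 1) ω j

/-- The column vector with entries `Y_1, …, Y_t`. -/
def responseVector {Ω : Type*} (Y : ℕ → Ω → ℝ) (t : ℕ) (ω : Ω) : Fin t → ℝ :=
  fun i => Y (i + 1) ω

/-- The two expressions for the covariance process agree. -/
theorem designMatrix_transpose_mul_self {Ω : Type*} {d : ℕ}
    (X : ℕ → Ω → EuclideanSpace ℝ (Fin d)) (t : ℕ) (ω : Ω) :
    (designMatrix X t ω).transpose * designMatrix X t ω = covarianceProcess X t ω := by
  ext i j
  rw [covarianceProcess, Matrix.sum_apply, Matrix.mul_apply]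
  have key := Finset.sum_Ico_add' (fun s => X s ω i * X s ω j) 0 t 1
  rw [Nat.Ico_zero_eq_range, Finset.sum_range] at key
  have hI : Finset.Ico (0 + 1) (t + 1) = Finset.Icc 1 t := by
    ext a
    simp only [Finset.mem_Ico, Finset.mem_Icc]
    omega
  rw [hI] at key
  simpa [designMatrix, Matrix.vecMulVec_apply] using key

/-- The ridge estimate `(𝐗_tᵀ 𝐗_t + ρ I)⁻¹ 𝐗_tᵀ 𝐘_t`. -/
def ridgeEstimate {Ω : Type*} {d : ℕ} (ρ : ℝ) (X : ℕ → Ω → EuclideanSpace ℝ (Fin d))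
    (Y : ℕ → Ω → ℝ) (t : ℕ) (ω : Ω) : EuclideanSpace ℝ (Fin d) :=
  WithLp.toLp 2
    (((designMatrix X t ω).transpose * designMatrix X t ω
        + ρ • (1 : Matrix (Fin d) (Fin d) ℝ))⁻¹.mulVec
      ((designMatrix X t ω).transpose.mulVec (responseVector Y t ω)))

/-- The online linear regression model with slope `θ`, covariates `X_t`, noise `ξ_t` and responses
`Y_t` (`t ≥ 1`; the values at index `0` play no role). -/
structure IsOnlineLinearRegression {Ω : Type*} {m : MeasurableSpace Ω} {d : ℕ} (μ : Measure Ω)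
    (ℱ : Filtration ℕ m) (ψ : ℝ → ℝ) (lmax : EReal) (θ : EuclideanSpace ℝ (Fin d))
    (X : ℕ → Ω → EuclideanSpace ℝ (Fin d)) (ξ Y : ℕ → Ω → ℝ) : Prop where
  cgfLike : IsCGFLike ψ lmax
  superGaussian : IsSuperGaussian ψ lmax
  predictable : ∀ t, 1 ≤ t → Measurable[ℱ (t - 1)] (X t)
  adapted_noise : ∀ t, 1 ≤ t → Measurable[ℱ t] (ξ t)
  response : ∀ t, 1 ≤ t → ∀ ω, Y t ω = inner ℝ (X t ω) θ + ξ t ω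
  subPsi : IsVectorSubPsi μ ℱ ψ lmax (residualProcess X ξ) (covarianceProcess X)

end

/-! ### The convex conjugate of a CGF-like function -/

/-! Write A = V_t + ρI. The normal equation
(`IsOnlineLinearRegression.toEuclideanLin_ridgeEstimate_sub`) splits A^{1/2}(θ̃_t − θ) into noise
A^{-1/2} S_t minus bias ρ A^{-1/2} θ. Since A ≥ ρI, the bias has norm at most √ρ‖θ‖
(`norm_matrixSqrt_inv_le`). The noise is controlled by `IsVectorSubPsi.exists_event_norm_lt`, as
follows.

In a fixed direction f, Ville's inequality keeps ⟨f, S_t⟩ below a prescribed line in the variance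
for all t at once. A line is sharp only near one variance, so lines are taken at the levels ρα^j;
the directions range over covers of the sphere of radius ε/β^k. The failure probabilities
`lineProbability` sum to at most δ, so all the bounds hold on one event
(`IsVectorSubPsi.exists_event`).

On that event the rest is deterministic, and k, f, j may depend on t and ω. The condition number of
A selects k, fine enough that some f in the cover recovers ‖A^{-1/2} S_t‖ up to the factor 1 − ε
(`exists_mem_cover_norm_le`). The variance W = ⟨f, A f⟩ selects j. The result is a bound by √W
(ψ*)⁻¹(αL/W)/(1 − ε), where L is the log boundary of A. Super-Gaussianity makes this nonincreasing
in W (`IsCGFLike.sqrt_mul_cgfConjInv_anti`), so W can be replaced by the smallest eigenvalue of A.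
-/

theorem zero_mem_cgfDomain {lmax : EReal} (h : 0 < lmax) : (0 : ℝ) ∈ cgfDomain lmax :=
  ⟨le_rfl, by simpa using h⟩

theorem ordConnected_cgfDomain (lmax : EReal) : (cgfDomain lmax).OrdConnected :=
  ⟨fun _ hx _ hy _ hz =>
    ⟨hx.1.trans hz.1, (EReal.coe_le_coe_iff.2 hz.2).trans_lt hy.2⟩⟩

theorem exists_pos_mem_cgfDomain {lmax : EReal} (h : 0 < lmax) : ∃ x ∈ cgfDomain lmax, 0 < x := by
  obtain ⟨x, hx0, hx⟩ := EReal.lt_iff_exists_real_btwn.1 h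
  have hx0' : 0 < x := by exact_mod_cast hx0
  exact ⟨x, ⟨hx0'.le, hx⟩, hx0'⟩

theorem uniqueDiffOn_cgfDomain {lmax : EReal} (h : 0 < lmax) :
    UniqueDiffOn ℝ (cgfDomain lmax) := by
  obtain ⟨x, hx, hx0⟩ := exists_pos_mem_cgfDomain h
  refine uniqueDiffOn_convex (ordConnected_cgfDomain lmax).convex ⟨x / 2, ?_⟩
  refine interior_mono ((ordConnected_cgfDomain lmax).out (zero_mem_cgfDomain h) hx) ?_
  rw [interior_Icc]
  constructor <;> linarith

namespace IsCGFLike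

variable {ψ : ℝ → ℝ} {lmax : EReal}

theorem zero_mem (hψ : IsCGFLike ψ lmax) : (0 : ℝ) ∈ cgfDomain lmax :=
  zero_mem_cgfDomain hψ.lmax_pos

theorem continuousOn_derivWithin (hψ : IsCGFLike ψ lmax) :
    ContinuousOn (derivWithin ψ (cgfDomain lmax)) (cgfDomain lmax) :=
  hψ.contDiffOn.continuousOn_derivWithin (uniqueDiffOn_cgfDomain hψ.lmax_pos) (by norm_num)

/-- The tangent lines of a CGF-like function lie below its graph. -/
theorem tangent_le (hψ : IsCGFLike ψ lmax) {x y : ℝ} (hx : x ∈ cgfDomain lmax)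
    (hy : y ∈ cgfDomain lmax) :
    ψ x + derivWithin ψ (cgfDomain lmax) x * (y - x) ≤ ψ y := by
  have hd := hψ.contDiffOn.differentiableOn (by norm_num) x hx
  have hc := hψ.strictConvexOn.convexOn
  rcases lt_trichotomy x y with h | h | h
  · have := hc.derivWithin_le_slope hx hy h hd
    rw [slope_def_field, le_div_iff₀ (by linarith)] at this
    linarith
  · subst h; simp
  · have := hc.slope_le_derivWithin hy hx h hd
    rw [slope_def_field, div_le_iff₀ (by linarith)] at this
    linarith

/-- Every nonnegative slope is attained by `ψ'`. -/
theorem exists_derivWithin_eq (hψ : IsCGFLike ψ lmax) (hs : HasUnboundedSlope ψ lmax) {u : ℝ}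
    (hu : 0 ≤ u) : ∃ x ∈ cgfDomain lmax, derivWithin ψ (cgfDomain lmax) x = u := by
  rw [HasUnboundedSlope, not_bddAbove_iff] at hs
  obtain ⟨_, ⟨y, hy, rfl⟩, huy⟩ := hs u
  exact (ordConnected_cgfDomain lmax).isPreconnected.intermediate_value hψ.zero_mem hy
    hψ.continuousOn_derivWithin ⟨by rwa [hψ.deriv_zero], huy.le⟩

theorem isGreatest_of_derivWithin_eq (hψ : IsCGFLike ψ lmax) {u x : ℝ}
    (hx : x ∈ cgfDomain lmax) (hu : derivWithin ψ (cgfDomain lmax) x = u) :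
    IsGreatest ((fun y => u * y - ψ y) '' cgfDomain lmax) (u * x - ψ x) := by
  refine ⟨⟨x, hx, rfl⟩, ?_⟩
  rintro _ ⟨y, hy, rfl⟩
  have := hψ.tangent_le hx hy
  simp only
  rw [hu] at this
  linarith

theorem cgfConj_eq_of_derivWithin_eq (hψ : IsCGFLike ψ lmax) {u x : ℝ}
    (hx : x ∈ cgfDomain lmax) (hu : derivWithin ψ (cgfDomain lmax) x = u) :
    cgfConj ψ lmax u = u * x - ψ x :=
  (hψ.isGreatest_of_derivWithin_eq hx hu).csSup_eq

/-- The supremum defining the conjugate is attained. -/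
theorem exists_cgfConj_eq (hψ : IsCGFLike ψ lmax) (hs : HasUnboundedSlope ψ lmax) {u : ℝ}
    (hu : 0 ≤ u) : ∃ x ∈ cgfDomain lmax, cgfConj ψ lmax u = u * x - ψ x := by
  obtain ⟨x, hx, hxu⟩ := hψ.exists_derivWithin_eq hs hu
  exact ⟨x, hx, hψ.cgfConj_eq_of_derivWithin_eq hx hxu⟩

/-- The Fenchel–Young inequality. -/
theorem mul_sub_le_cgfConj (hψ : IsCGFLike ψ lmax) (hs : HasUnboundedSlope ψ lmax) {u x : ℝ}
    (hu : 0 ≤ u) (hx : x ∈ cgfDomain lmax) : u * x - ψ x ≤ cgfConj ψ lmax u := by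
  obtain ⟨y, hy, hyu⟩ := hψ.exists_derivWithin_eq hs hu
  rw [hψ.cgfConj_eq_of_derivWithin_eq hy hyu]
  exact (hψ.isGreatest_of_derivWithin_eq hy hyu).2 ⟨x, hx, rfl⟩

/-- Along u = ψ'(x) the conjugate equals x ψ'(x) − ψ(x), which is continuous in x and vanishes at 0.
The intermediate value theorem is applied to this function of x, so continuity of the conjugate
itself is not needed. -/
theorem exists_eq_cgfConj (hψ : IsCGFLike ψ lmax) (hs : HasUnboundedSlope ψ lmax) {y : ℝ}
    (hy : 0 ≤ y) : ∃ u ∈ Set.Ici (0 : ℝ), cgfConj ψ lmax u = y := by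
  obtain ⟨z, hz, hz0⟩ := exists_pos_mem_cgfDomain hψ.lmax_pos
  have hzψ := hψ.nonneg z hz
  -- At this slope the competitor `z` alone gives the value `y`, so the supremum is at least `y`.
  have hu : 0 ≤ (y + ψ z) / z := by positivity
  obtain ⟨b, hb, hbu⟩ := hψ.exists_derivWithin_eq hs hu
  have hyb : y ≤ derivWithin ψ (cgfDomain lmax) b * b - ψ b := by
    have := (hψ.isGreatest_of_derivWithin_eq hb hbu).2 ⟨z, hz, rfl⟩
    simp only at this
    rw [div_mul_cancel₀ _ hz0.ne'] at this
    rw [hbu]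
    linarith
  obtain ⟨x, hx, hxy⟩ := (ordConnected_cgfDomain lmax).isPreconnected.intermediate_value
    hψ.zero_mem hb
    ((hψ.continuousOn_derivWithin.mul continuousOn_id).sub hψ.contDiffOn.continuousOn)
    (show y ∈ Set.Icc _ _ from ⟨by simpa [hψ.map_zero] using hy, hyb⟩)
  replace hxy : derivWithin ψ (cgfDomain lmax) x * x - ψ x = y := hxy
  refine ⟨_, ?_, (hψ.cgfConj_eq_of_derivWithin_eq hx rfl).trans hxy⟩
  rcases hx.1.eq_or_lt with h | h
  · rw [← h, hψ.deriv_zero]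
    exact Set.self_mem_Ici
  · have := hψ.nonneg x hx
    exact le_of_mul_le_mul_right (by linarith) h

theorem cgfConjInv_nonneg (hψ : IsCGFLike ψ lmax) (hs : HasUnboundedSlope ψ lmax) {y : ℝ}
    (hy : 0 ≤ y) : 0 ≤ cgfConjInv ψ lmax y :=
  Function.invFunOn_mem (hψ.exists_eq_cgfConj hs hy)

theorem cgfConj_cgfConjInv (hψ : IsCGFLike ψ lmax) (hs : HasUnboundedSlope ψ lmax) {y : ℝ}
    (hy : 0 ≤ y) : cgfConj ψ lmax (cgfConjInv ψ lmax y) = y :=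
  Function.invFunOn_eq (hψ.exists_eq_cgfConj hs hy)

/-- The conjugate is strictly increasing where it is positive. -/
theorem cgfConj_lt_cgfConj (hψ : IsCGFLike ψ lmax) (hs : HasUnboundedSlope ψ lmax) {u v : ℝ}
    (hu : 0 ≤ u) (huv : u < v) (hpos : 0 < cgfConj ψ lmax u) :
    cgfConj ψ lmax u < cgfConj ψ lmax v := by
  obtain ⟨x, hx, hxu⟩ := hψ.exists_cgfConj_eq hs hu
  have hx0 : 0 < x := by
    refine hx.1.lt_of_ne fun h => ?_
    rw [hxu, ← h, hψ.map_zero] at hpos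
    simp at hpos
  have := hψ.mul_sub_le_cgfConj hs (hu.trans huv.le) hx
  have := mul_lt_mul_of_pos_right huv hx0
  linarith

theorem cgfConjInv_le (hψ : IsCGFLike ψ lmax) (hs : HasUnboundedSlope ψ lmax) {y u : ℝ}
    (hy : 0 < y) (hu : 0 ≤ u) (h : y ≤ cgfConj ψ lmax u) : cgfConjInv ψ lmax y ≤ u := by
  by_contra! hlt
  have := hψ.cgfConj_lt_cgfConj hs hu hlt (hy.trans_le h)
  rw [hψ.cgfConj_cgfConjInv hs hy.le] at this
  linarith

theorem le_cgfConjInv (hψ : IsCGFLike ψ lmax) (hs : HasUnboundedSlope ψ lmax) {y u : ℝ}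
    (hy : 0 < y) (h : cgfConj ψ lmax u ≤ y) : u ≤ cgfConjInv ψ lmax y := by
  by_contra! hlt
  have hc := hψ.cgfConj_cgfConjInv hs hy.le
  have := hψ.cgfConj_lt_cgfConj hs (hψ.cgfConjInv_nonneg hs hy.le) hlt (by rwa [hc])
  linarith

theorem cgfConjInv_mono (hψ : IsCGFLike ψ lmax) (hs : HasUnboundedSlope ψ lmax) {y z : ℝ}
    (hy : 0 < y) (h : y ≤ z) : cgfConjInv ψ lmax y ≤ cgfConjInv ψ lmax z :=
  hψ.cgfConjInv_le hs hy (hψ.cgfConjInv_nonneg hs (hy.le.trans h))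
    (by rwa [hψ.cgfConj_cgfConjInv hs (hy.le.trans h)])

/-- For super-Gaussian `ψ` the conjugate grows at most quadratically. -/
theorem cgfConj_mul_le (hψ : IsCGFLike ψ lmax) (hs : HasUnboundedSlope ψ lmax)
    (hg : IsSuperGaussian ψ lmax) {r u : ℝ} (hr : 1 ≤ r) (hu : 0 ≤ u) :
    cgfConj ψ lmax (r * u) ≤ r ^ 2 * cgfConj ψ lmax u := by
  have hr0 : 0 < r := one_pos.trans_le hr
  obtain ⟨x, hx, hxu⟩ := hψ.exists_cgfConj_eq hs (mul_nonneg hr0.le hu)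
  have hxr : x / r ≤ x := div_le_self hx.1 hr
  have hmem : x / r ∈ cgfDomain lmax :=
    (ordConnected_cgfDomain lmax).out hψ.zero_mem hx ⟨div_nonneg hx.1 hr0.le, hxr⟩
  -- This is monotonicity of ψ(x)/x² between x/r and x; the rescaled maximizer x/r then serves as a
  -- competitor at `u`.
  have key : r ^ 2 * ψ (x / r) ≤ ψ x := by
    rcases hx.1.eq_or_lt with h | h
    · simp [← h, hψ.map_zero]
    · have := hg ⟨div_pos h hr0, hmem.2⟩ ⟨h, hx.2⟩ hxr
      simp only at this
      rw [div_pow, div_div_eq_mul_div, div_le_div_iff_of_pos_right (by positivity)] at this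
      linarith
  have := mul_le_mul_of_nonneg_left (hψ.mul_sub_le_cgfConj hs hu hmem) (sq_nonneg r)
  rw [hxu]
  have e : r ^ 2 * (u * (x / r) - ψ (x / r)) = r * u * x - r ^ 2 * ψ (x / r) := by field_simp
  linarith

/-- For super-Gaussian `ψ` the function `v ↦ √v (ψ*)⁻¹(c / v)` is nonincreasing. -/
theorem sqrt_mul_cgfConjInv_anti (hψ : IsCGFLike ψ lmax) (hs : HasUnboundedSlope ψ lmax)
    (hg : IsSuperGaussian ψ lmax) {c v w : ℝ} (hc : 0 < c) (hv : 0 < v) (hvw : v ≤ w) :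
    √w * cgfConjInv ψ lmax (c / w) ≤ √v * cgfConjInv ψ lmax (c / v) := by
  have hw : 0 < w := hv.trans_le hvw
  have hcw : 0 < c / w := div_pos hc hw
  set u := cgfConjInv ψ lmax (c / w)
  have hu : 0 ≤ u := hψ.cgfConjInv_nonneg hs hcw.le
  -- With this dilation r² · (c/w) = c/v, so quadratic growth bounds the conjugate at r u by c/v.
  have hr : 1 ≤ √(w / v) := Real.one_le_sqrt.2 ((one_le_div hv).2 hvw)
  have h1 := hψ.cgfConj_mul_le hs hg hr hu
  rw [hψ.cgfConj_cgfConjInv hs hcw.le, Real.sq_sqrt (by positivity),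
    show w / v * (c / w) = c / v by field_simp] at h1
  have h2 := mul_le_mul_of_nonneg_left (hψ.le_cgfConjInv hs (div_pos hc hv) h1) (Real.sqrt_nonneg v)
  rwa [← mul_assoc, ← Real.sqrt_mul hv.le, mul_div_cancel₀ _ hv.ne'] at h2

end IsCGFLike

/-! ### Ville's inequality -/

/-- Ville's inequality on a finite horizon, with the remaining mass of the supermartingale on the
event that the level `c` has not been reached. -/
theorem MeasureTheory.Supermartingale.mul_measureReal_add_setIntegral_le {Ω : Type*}
    {m : MeasurableSpace Ω} {μ : Measure Ω} [IsFiniteMeasure μ] {ℱ : Filtration ℕ m}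
    {L : ℕ → Ω → ℝ} (hL : Supermartingale L ℱ μ) (c : ℝ) (n : ℕ) :
    c * μ.real {ω | ∃ t ≤ n, c ≤ L t ω} + ∫ ω in {ω | ∃ t ≤ n, c ≤ L t ω}ᶜ, L n ω ∂μ
      ≤ ∫ ω, L 0 ω ∂μ := by
  have hmeas : ∀ n, MeasurableSet[ℱ n] {ω | ∃ t ≤ n, c ≤ L t ω} := fun n => by
    have : {ω | ∃ t ≤ n, c ≤ L t ω} = ⋃ t, ⋃ (_ : t ≤ n), {ω | c ≤ L t ω} := by
      ext; simp
    rw [this]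
    refine MeasurableSet.iUnion fun t => MeasurableSet.iUnion fun ht => ?_
    exact measurableSet_le measurable_const ((hL.1 t).measurable.mono (ℱ.mono ht) le_rfl)
  have hset : ∀ (k n : ℕ) {s : Set Ω}, MeasurableSet s → (∀ ω ∈ s, c ≤ L k ω) →
      c * μ.real s ≤ ∫ ω in s, L k ω ∂μ := fun k n s hs h => by
    have := setIntegral_mono_on (integrableOn_const (C := c) (measure_ne_top μ s))
      (hL.integrable k).integrableOn hs h
    rwa [setIntegral_const, smul_eq_mul, mul_comm] at this
  induction n with
  | zero =>
    have h0 := ℱ.le 0 _ (hmeas 0)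
    have := hset 0 0 h0 (by simp)
    rw [← integral_add_compl h0 (hL.integrable 0)]
    linarith
  | succ n ih =>
    set A := {ω | ∃ t ≤ n, c ≤ L t ω}
    set B := {ω | ∃ t ≤ n + 1, c ≤ L t ω}
    have hA : MeasurableSet A := ℱ.le _ _ (hmeas n)
    have hB : MeasurableSet B := ℱ.le _ _ (hmeas (n + 1))
    have hAB : A ⊆ B := fun ω ⟨t, ht, h⟩ => ⟨t, ht.trans n.le_succ, h⟩
    -- The mass on `Aᶜ` does not increase from time n to n + 1, and it splits into `B \ A`, where
    -- the level is first reached at time n + 1, and `Bᶜ`.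
    have h1 := hL.setIntegral_le n.le_succ (hmeas n).compl
    have h2 : ∫ ω in Aᶜ, L (n + 1) ω ∂μ
        = ∫ ω in B \ A, L (n + 1) ω ∂μ + ∫ ω in Bᶜ, L (n + 1) ω ∂μ := by
      rw [← setIntegral_union (Disjoint.mono_left Set.sdiff_subset disjoint_compl_right) hB.compl
        (hL.integrable _).integrableOn (hL.integrable _).integrableOn]
      congr 2
      ext ω
      have := @hAB ω
      simp only [Set.mem_compl_iff, Set.mem_union, Set.mem_sdiff]
      tauto
    have h3 := hset (n + 1) 0 (hB.diff hA) (by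
      rintro ω ⟨⟨t, ht, h⟩, hn⟩
      rcases ht.lt_or_eq with h' | rfl
      · exact absurd ⟨t, Nat.lt_succ_iff.1 h', h⟩ hn
      · exact h)
    rw [measureReal_sdiff hAB hA] at h3
    simp only [Nat.succ_eq_add_one] at h1
    linarith

/-- Ville's inequality for a nonnegative supermartingale. -/
theorem MeasureTheory.Supermartingale.measure_exists_le {Ω : Type*} {m : MeasurableSpace Ω}
    {μ : Measure Ω} [IsFiniteMeasure μ] {ℱ : Filtration ℕ m} {L : ℕ → Ω → ℝ}
    (hL : Supermartingale L ℱ μ) (hnonneg : ∀ t, 0 ≤ᵐ[μ] L t) {c : ℝ} (hc : 0 < c) :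
    μ {ω | ∃ t, c ≤ L t ω} ≤ ENNReal.ofReal ((∫ ω, L 0 ω ∂μ) / c) := by
  have hU : {ω | ∃ t, c ≤ L t ω} = ⋃ n, {ω | ∃ t ≤ n, c ≤ L t ω} := by
    ext ω
    simp only [Set.mem_ofPred_eq, Set.mem_iUnion]
    exact ⟨fun ⟨t, ht⟩ => ⟨t, t, le_rfl, ht⟩, fun ⟨_, t, _, ht⟩ => ⟨t, ht⟩⟩
  have hmono : Monotone fun n : ℕ => {ω | ∃ t ≤ n, c ≤ L t ω} :=
    fun a b hab ω ⟨t, ht, h⟩ => ⟨t, ht.trans hab, h⟩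
  rw [hU, hmono.measure_iUnion]
  refine iSup_le fun n => ?_
  rw [← ofReal_measureReal]
  refine ENNReal.ofReal_le_ofReal ?_
  rw [le_div_iff₀ hc, mul_comm]
  have h1 := hL.mul_measureReal_add_setIntegral_le c n
  have h2 : 0 ≤ ∫ ω in {ω | ∃ t ≤ n, c ≤ L t ω}ᶜ, L n ω ∂μ :=
    setIntegral_nonneg_of_ae (hnonneg n)
  linarith

/-- A sub-`ψ` process stays below each line with the stated probability. -/
theorem IsSubPsi.measure_exists_le {Ω : Type*} {m : MeasurableSpace Ω} {μ : Measure Ω}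
    [IsFiniteMeasure μ] {ℱ : Filtration ℕ m} {ψ : ℝ → ℝ} {lmax : EReal} {S V : ℕ → Ω → ℝ}
    (h : IsSubPsi μ ℱ ψ lmax S V) {l : ℝ} (hl : l ∈ cgfDomain lmax) {p : ℝ} (hp : 0 < p) :
    μ {ω | ∃ t, Real.log (1 / p) ≤ l * S t ω - ψ l * V t ω} ≤ ENNReal.ofReal p := by
  obtain ⟨L, hL, hnonneg, hL0, hdom⟩ := h.dominated l hl
  have hle : {ω | ∃ t, Real.log (1 / p) ≤ l * S t ω - ψ l * V t ω}
      ≤ᵐ[μ] {ω | ∃ t, 1 / p ≤ L t ω} := by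
    filter_upwards [ae_all_iff.2 hdom] with ω hω
    rintro ⟨t, ht⟩
    refine ⟨t, le_trans ?_ (hω t)⟩
    rwa [← Real.log_le_iff_le_exp (by positivity)]
  refine (measure_mono_ae hle).trans
    ((hL.measure_exists_le hnonneg (one_div_pos.2 hp)).trans (ENNReal.ofReal_le_ofReal ?_))
  rw [div_div_eq_mul_div, div_one]
  nlinarith

/-! ### Spectral bounds for symmetric matrices -/

section Spectral

variable {d : ℕ} {A : Matrix (Fin d) (Fin d) ℝ}

theorem finite_spectrum (hA : A.IsHermitian) : (spectrum ℝ A).Finite := by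
  rw [hA.spectrum_real_eq_range_eigenvalues]
  exact Set.finite_range _

theorem spectrum_nonempty (hA : A.IsHermitian) (hd : 1 ≤ d) : (spectrum ℝ A).Nonempty := by
  rw [hA.spectrum_real_eq_range_eigenvalues]
  exact ⟨_, ⟨0, hd⟩, rfl⟩

theorem inner_toEuclideanLin_nonneg (hA : A.PosSemidef) (x : EuclideanSpace ℝ (Fin d)) :
    0 ≤ inner ℝ x (Matrix.toEuclideanLin A x) := by
  simpa using (Matrix.isPositive_toEuclideanLin_iff.2 hA).inner_nonneg_right x

theorem toEuclideanLin_algebraMap (r : ℝ) (x : EuclideanSpace ℝ (Fin d)) :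
    Matrix.toEuclideanLin (algebraMap ℝ (Matrix (Fin d) (Fin d) ℝ) r) x = r • x := by
  rw [Matrix.toLpLin_apply]
  ext i
  simp [Algebra.algebraMap_eq_smul_one, Matrix.smul_mulVec]

open scoped MatrixOrder in
-- A lower bound on the spectrum is a comparison with a scalar matrix in the Loewner order, which is
-- a statement about quadratic forms.
theorem le_inner_toEuclideanLin (hA : A.IsHermitian) {r : ℝ} (h : ∀ x ∈ spectrum ℝ A, r ≤ x)
    (x : EuclideanSpace ℝ (Fin d)) :
    r * ‖x‖ ^ 2 ≤ inner ℝ x (Matrix.toEuclideanLin A x) := by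
  have hle := (algebraMap_le_iff_le_spectrum (a := A) hA).2 h
  have := inner_toEuclideanLin_nonneg (Matrix.le_iff.1 hle) x
  rw [map_sub, LinearMap.sub_apply, inner_sub_right, toEuclideanLin_algebraMap, inner_smul_right,
    real_inner_self_eq_norm_sq] at this
  linarith

open scoped MatrixOrder in
theorem inner_toEuclideanLin_le (hA : A.IsHermitian) {r : ℝ} (h : ∀ x ∈ spectrum ℝ A, x ≤ r)
    (x : EuclideanSpace ℝ (Fin d)) :
    inner ℝ x (Matrix.toEuclideanLin A x) ≤ r * ‖x‖ ^ 2 := by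
  have hle := (le_algebraMap_iff_spectrum_le (a := A) hA).2 h
  have := inner_toEuclideanLin_nonneg (Matrix.le_iff.1 hle) x
  rw [map_sub, LinearMap.sub_apply, inner_sub_right, toEuclideanLin_algebraMap, inner_smul_right,
    real_inner_self_eq_norm_sq] at this
  linarith

theorem gammaMin_mul_le_inner (hA : A.IsHermitian) (x : EuclideanSpace ℝ (Fin d)) :
    gammaMin A * ‖x‖ ^ 2 ≤ inner ℝ x (Matrix.toEuclideanLin A x) :=
  le_inner_toEuclideanLin hA (fun _ hx => csInf_le (finite_spectrum hA).bddBelow hx) x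

theorem inner_le_gammaMax_mul (hA : A.IsHermitian) (x : EuclideanSpace ℝ (Fin d)) :
    inner ℝ x (Matrix.toEuclideanLin A x) ≤ gammaMax A * ‖x‖ ^ 2 :=
  inner_toEuclideanLin_le hA (fun _ hx => le_csSup (finite_spectrum hA).bddAbove hx) x

theorem gammaMin_le_gammaMax (hA : A.IsHermitian) (hd : 1 ≤ d) : gammaMin A ≤ gammaMax A := by
  obtain ⟨x, hx⟩ := spectrum_nonempty hA hd
  exact (csInf_le (finite_spectrum hA).bddBelow hx).trans
    (le_csSup (finite_spectrum hA).bddAbove hx)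

theorem isHermitian_matrixSqrt (A : Matrix (Fin d) (Fin d) ℝ) : (matrixSqrt A).IsHermitian :=
  cfc_predicate (p := IsSelfAdjoint) Real.sqrt A

open scoped MatrixOrder in
theorem spectrum_nonneg_of_posSemidef (hA : A.PosSemidef) {x : ℝ} (hx : x ∈ spectrum ℝ A) :
    0 ≤ x :=
  spectrum_nonneg_of_nonneg hA.nonneg hx

theorem matrixSqrt_mul_self (hA : A.PosSemidef) : matrixSqrt A * matrixSqrt A = A := by
  have ha : IsSelfAdjoint A := hA.1
  rw [matrixSqrt, ← cfc_mul Real.sqrt Real.sqrt A]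
  conv_rhs => rw [← cfc_id ℝ A]
  exact cfc_congr fun x hx => Real.mul_self_sqrt (spectrum_nonneg_of_posSemidef hA hx)

theorem le_of_mem_spectrum_add_smul_one (hA : A.PosSemidef) {ρ x : ℝ}
    (hx : x ∈ spectrum ℝ (A + ρ • (1 : Matrix (Fin d) (Fin d) ℝ))) : ρ ≤ x := by
  rw [← Algebra.algebraMap_eq_smul_one, ← sub_add_cancel x ρ, add_comm A, spectrum.add_mem_add_iff (s := ρ)] at hx
  linarith [spectrum_nonneg_of_posSemidef hA hx]

theorem posDef_add_smul_one (hA : A.PosSemidef) {ρ : ℝ} (hρ : 0 < ρ) :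
    (A + ρ • (1 : Matrix (Fin d) (Fin d) ℝ)).PosDef :=
  (Matrix.PosDef.one.smul hρ).posSemidef_add hA

theorem le_gammaMin_add_smul_one (hA : A.PosSemidef) (hd : 1 ≤ d) {ρ : ℝ} (hρ : 0 < ρ) :
    ρ ≤ gammaMin (A + ρ • (1 : Matrix (Fin d) (Fin d) ℝ)) :=
  le_csInf (spectrum_nonempty (posDef_add_smul_one hA hρ).1 hd)
    fun _ => le_of_mem_spectrum_add_smul_one hA

/-- Truncation at ρ does nothing to a matrix already shifted by ρI, so `logBoundary` is expressed
through the eigenvalues of that matrix itself. -/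
theorem eigenvalueMax_add_smul_one (hA : A.PosSemidef) {ρ : ℝ} (hρ : 0 < ρ) :
    eigenvalueMax (A + ρ • (1 : Matrix (Fin d) (Fin d) ℝ)) ρ
      = A + ρ • (1 : Matrix (Fin d) (Fin d) ℝ) := by
  have ha : IsSelfAdjoint (A + ρ • (1 : Matrix (Fin d) (Fin d) ℝ)) :=
    (posDef_add_smul_one hA hρ).1
  rw [eigenvalueMax]
  conv_rhs => rw [← cfc_id ℝ (A + ρ • (1 : Matrix (Fin d) (Fin d) ℝ))]
  exact cfc_congr fun x hx => max_eq_left (le_of_mem_spectrum_add_smul_one hA hx)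

theorem toEuclideanLin_mul_apply (B C : Matrix (Fin d) (Fin d) ℝ)
    (x : EuclideanSpace ℝ (Fin d)) :
    Matrix.toEuclideanLin (B * C) x = Matrix.toEuclideanLin B (Matrix.toEuclideanLin C x) := by
  simp [Matrix.toLpLin_apply, Matrix.mulVec_mulVec]

theorem inner_matrixSqrt_left (A : Matrix (Fin d) (Fin d) ℝ) (x y : EuclideanSpace ℝ (Fin d)) :
    inner ℝ (Matrix.toEuclideanLin (matrixSqrt A) x) y
      = inner ℝ x (Matrix.toEuclideanLin (matrixSqrt A) y) :=
  Matrix.isSymmetric_toEuclideanLin_iff.2 (isHermitian_matrixSqrt A) x y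

theorem norm_matrixSqrt_sq (hA : A.PosSemidef) (x : EuclideanSpace ℝ (Fin d)) :
    ‖Matrix.toEuclideanLin (matrixSqrt A) x‖ ^ 2 = inner ℝ x (Matrix.toEuclideanLin A x) := by
  rw [← real_inner_self_eq_norm_sq, inner_matrixSqrt_left, ← toEuclideanLin_mul_apply,
    matrixSqrt_mul_self hA]

theorem toEuclideanLin_mul_inv (hA : A.PosDef) (x : EuclideanSpace ℝ (Fin d)) :
    Matrix.toEuclideanLin A (Matrix.toEuclideanLin A⁻¹ x) = x := by
  rw [← toEuclideanLin_mul_apply, Matrix.mul_nonsing_inv _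
    ((Matrix.isUnit_iff_isUnit_det A).1 hA.isUnit)]
  simp

theorem toEuclideanLin_inv_mul (hA : A.PosDef) (x : EuclideanSpace ℝ (Fin d)) :
    Matrix.toEuclideanLin A⁻¹ (Matrix.toEuclideanLin A x) = x := by
  rw [← toEuclideanLin_mul_apply, Matrix.nonsing_inv_mul _
    ((Matrix.isUnit_iff_isUnit_det A).1 hA.isUnit)]
  simp

end Spectral

/-! ### Covers of the sphere -/

/-- Compactness makes the covering number finite, so `toNat` in `sphereCoveringNumber` never takes
its default value at ⊤ and an optimal cover exists. -/
theorem exists_finset_sphere_cover (d : ℕ) {r : ℝ} (hr : 0 < r) :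
    ∃ K : Finset (EuclideanSpace ℝ (Fin d)), (∀ f ∈ K, ‖f‖ = 1) ∧
      (∀ e, ‖e‖ = 1 → ∃ f ∈ K, ‖e - f‖ ≤ r) ∧ K.card = sphereCoveringNumber d r := by
  have hr' : r.toNNReal ≠ 0 := by simpa using hr
  have hfin : Metric.coveringNumber r.toNNReal
      (Metric.sphere (0 : EuclideanSpace ℝ (Fin d)) 1) ≠ ⊤ := by
    obtain ⟨N, hN, hNf, hNc⟩ := Metric.exists_finite_isCover_of_isCompact hr'
      (isCompact_sphere (0 : EuclideanSpace ℝ (Fin d)) 1)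
    exact ne_top_of_le_ne_top (by simpa using hNf) (hNc.coveringNumber_le_encard hN)
  obtain ⟨C, hC, hCf, hCc, hcard⟩ := Metric.exists_set_encard_eq_coveringNumber hfin
  refine ⟨hCf.toFinset, fun f hf => ?_, fun e he => ?_, ?_⟩
  · simpa using hC (hCf.mem_toFinset.1 hf)
  · obtain ⟨f, hf, hef⟩ := hCc (show e ∈ Metric.sphere 0 1 by simpa using he)
    refine ⟨f, hCf.mem_toFinset.2 hf, ?_⟩
    rw [← dist_eq_norm]
    have : edist e f ≤ ENNReal.ofReal r := hef
    rwa [edist_dist, ENNReal.ofReal_le_ofReal_iff hr.le] at this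
  · rw [sphereCoveringNumber, ← hcard, hCf.encard_eq_coe_toFinset_card, ENat.toNat_natCast]

theorem sphere_nonempty {d : ℕ} (hd : 1 ≤ d) : ∃ e : EuclideanSpace ℝ (Fin d), ‖e‖ = 1 :=
  ⟨EuclideanSpace.single ⟨0, hd⟩ 1, by simp⟩

theorem sphereCoveringNumber_pos {d : ℕ} (hd : 1 ≤ d) {r : ℝ} (hr : 0 < r) :
    0 < sphereCoveringNumber d r := by
  obtain ⟨K, -, hK, hcard⟩ := exists_finset_sphere_cover d hr
  obtain ⟨e, he⟩ := sphere_nonempty hd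
  obtain ⟨f, hf, -⟩ := hK e he
  rw [← hcard]
  exact Finset.card_pos.2 ⟨f, hf⟩

theorem sphereCoveringNumber_anti (d : ℕ) {r s : ℝ} (hr : 0 < r) (hrs : r ≤ s) :
    sphereCoveringNumber d s ≤ sphereCoveringNumber d r := by
  obtain ⟨K, hK1, hK, hcard⟩ := exists_finset_sphere_cover d hr
  rw [← hcard, sphereCoveringNumber]
  refine ENat.toNat_le_of_le_natCast ?_
  rw [← Set.encard_coe_eq_coe_finsetCard]
  refine Metric.IsCover.coveringNumber_le_encard (fun f hf => by simpa using hK1 f hf)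
    fun e he => ?_
  obtain ⟨f, hf, hef⟩ := hK e (by simpa using he)
  refine ⟨f, hf, ?_⟩
  change edist e f ≤ ENNReal.ofReal s
  rw [edist_dist, dist_eq_norm]
  exact ENNReal.ofReal_le_ofReal (hef.trans hrs)

/-! ### Reduction to finitely many directions -/

/-- If `K` is a cover of the sphere that is fine compared with the condition number of `A`, then
the norm of `p` is comparable with one of the normalized projections of `A ^ (1/2) p` on the
directions of `K`. -/
theorem exists_mem_cover_norm_le {d : ℕ} (hd : 1 ≤ d) {A : Matrix (Fin d) (Fin d) ℝ}
    (hA : A.PosDef) (hγ : 0 < gammaMin A) {ε r : ℝ} (hε : ε ∈ Set.Ioo (0 : ℝ) 1)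
    (hr : gammaMax A * r ^ 2 ≤ ε ^ 2 * gammaMin A) {K : Finset (EuclideanSpace ℝ (Fin d))}
    (hK1 : ∀ f ∈ K, ‖f‖ = 1) (hK : ∀ e, ‖e‖ = 1 → ∃ f ∈ K, ‖e - f‖ ≤ r)
    (p : EuclideanSpace ℝ (Fin d)) :
    ∃ f ∈ K, (1 - ε) * ‖p‖ * √(inner ℝ f (Matrix.toEuclideanLin A f))
      ≤ inner ℝ f (Matrix.toEuclideanLin (matrixSqrt A) p) := by
  set R := Matrix.toEuclideanLin (matrixSqrt A) with hR
  have hnorm : ∀ x, ‖R x‖ ^ 2 = inner ℝ x (Matrix.toEuclideanLin A x) :=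
    norm_matrixSqrt_sq hA.posSemidef
  obtain ⟨ν, hν, hpν⟩ : ∃ ν : EuclideanSpace ℝ (Fin d), ‖ν‖ = 1 ∧ p = ‖p‖ • ν := by
    rcases eq_or_ne p 0 with rfl | hp
    · obtain ⟨e, he⟩ := sphere_nonempty hd
      exact ⟨e, he, by simp⟩
    · refine ⟨‖p‖⁻¹ • p, by simp [norm_smul, hp], ?_⟩
      rw [smul_smul, mul_inv_cancel₀ (norm_ne_zero_iff.2 hp), one_smul]
  -- This is x = A^{-1/2} ν. The cover approximates the direction of x rather than ν, because
  -- A^{1/2} maps x to ν.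
  set x := R (Matrix.toEuclideanLin A⁻¹ ν)
  have hRx : R x = ν := by
    rw [hR, ← toEuclideanLin_mul_apply, matrixSqrt_mul_self hA.posSemidef,
      toEuclideanLin_mul_inv hA]
  have hx : x ≠ 0 := by
    intro h
    rw [h, map_zero] at hRx
    simp [← hRx] at hν
  have hx0 : 0 < ‖x‖ := norm_pos_iff.2 hx
  obtain ⟨f, hf, hfr⟩ := hK (‖x‖⁻¹ • x) (by simp [norm_smul, hx])
  refine ⟨f, hf, ?_⟩
  set e := ‖x‖⁻¹ • x
  have he1 : ‖e‖ = 1 := by simp [e, norm_smul, hx]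
  set a := R e
  set b := R f
  have hν' : ν = ‖x‖ • a := by
    simp only [a, e, map_smul, hRx]
    rw [smul_smul, mul_inv_cancel₀ hx0.ne', one_smul]
  have ha : gammaMin A ≤ ‖a‖ ^ 2 := by
    have := gammaMin_mul_le_inner hA.1 e
    rwa [he1, one_pow, mul_one, ← hnorm] at this
  have hb : gammaMin A ≤ ‖b‖ ^ 2 := by
    have := gammaMin_mul_le_inner hA.1 f
    rwa [hK1 f hf, one_pow, mul_one, ← hnorm] at this
  have hab : gammaMin A ≤ ‖a‖ * ‖b‖ := by
    have ha' := Real.sqrt_le_sqrt ha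
    have hb' := Real.sqrt_le_sqrt hb
    rw [Real.sqrt_sq (norm_nonneg _)] at ha' hb'
    calc gammaMin A = √(gammaMin A) * √(gammaMin A) := (Real.mul_self_sqrt hγ.le).symm
      _ ≤ _ := mul_le_mul ha' hb' (Real.sqrt_nonneg _) (norm_nonneg _)
  -- A^{1/2} stretches `e - f` by at most the root of the largest eigenvalue, and the choice of `r`
  -- makes this small relative to the smallest one, hence to `‖a‖ * ‖b‖`.
  have hdist : ‖a - b‖ ^ 2 ≤ ε ^ 2 * (‖a‖ * ‖b‖) := by
    have h1 := inner_le_gammaMax_mul hA.1 (e - f)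
    rw [← hnorm, map_sub] at h1
    have hΓ : 0 ≤ gammaMax A := hγ.le.trans (gammaMin_le_gammaMax hA.1 hd)
    have h2 : gammaMax A * ‖e - f‖ ^ 2 ≤ gammaMax A * r ^ 2 := by gcongr
    have h3 := mul_le_mul_of_nonneg_left hab (sq_nonneg ε)
    linarith
  -- Polarization and ‖a‖² + ‖b‖² ≥ 2‖a‖‖b‖ give 2⟨a, b⟩ ≥ (2 − ε²)‖a‖‖b‖, and ε² ≤ 2ε.
  have hinner : (1 - ε) * (‖a‖ * ‖b‖) ≤ inner ℝ a b := by
    have h1 := norm_sub_sq_real a b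
    have h2 := two_mul_le_add_sq ‖a‖ ‖b‖
    have h3 : ε ^ 2 * (‖a‖ * ‖b‖) ≤ ε * (‖a‖ * ‖b‖) := by
      refine mul_le_mul_of_nonneg_right ?_ (by positivity)
      nlinarith [hε.1, hε.2]
    have h4 : 0 ≤ ε * (‖a‖ * ‖b‖) := mul_nonneg hε.1.le (by positivity)
    linarith
  have hxa : ‖x‖ * ‖a‖ = 1 := by
    rw [← hν, hν', norm_smul, norm_norm]
  rw [← hnorm, Real.sqrt_sq (norm_nonneg _), hR, ← inner_matrixSqrt_left]
  change _ ≤ inner ℝ b p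
  conv_rhs => rw [hpν, hν', inner_smul_right, inner_smul_right, real_inner_comm]
  calc (1 - ε) * ‖p‖ * ‖b‖ = ‖p‖ * (‖x‖ * ((1 - ε) * (‖a‖ * ‖b‖))) := by
        linear_combination (-(1 - ε) * ‖p‖ * ‖b‖) * hxa
    _ ≤ _ := by gcongr

/-! ### Stitching -/

/-- A line tangent at the variance level `v` gives a bound at every larger variance `w`. -/
theorem IsCGFLike.lt_mul_of_line {ψ : ℝ → ℝ} {lmax : EReal} (hψ : IsCGFLike ψ lmax)
    {u l c v w s : ℝ} (hl : l ∈ cgfDomain lmax) (hc : 0 < c) (hv : 0 < v) (hvw : v ≤ w)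
    (hu : u * l - ψ l = c / v) (hs : l * s - ψ l * w < c) : s < w * u := by
  have hl0 : 0 < l := by
    refine hl.1.lt_of_ne fun h => ?_
    rw [← h, hψ.map_zero] at hu
    have := div_pos hc hv
    linarith
  -- The intercept c is traded for slope: l s < c + ψ(l) w ≤ (c/v + ψ(l)) w = u l w.
  have h1 : c ≤ c / v * w := by
    rw [div_mul_eq_mul_div, le_div_iff₀ hv]
    exact mul_le_mul_of_nonneg_left hvw hc.le
  rw [← hu] at h1
  refine lt_of_mul_lt_mul_left (a := l) ?_ hl0.le
  linarith

/-- The probability spent on one line: for scale `k` of the cover, epoch `j` of the variance, and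
each of the `N` directions of the cover. -/
noncomputable def lineProbability (β δ : ℝ) (h : ℝ → ℝ) (N : ℕ) (k j : ℕ) : ℝ :=
  δ * (1 - β⁻¹) * (β⁻¹) ^ k / N * (h j)⁻¹

section LineProbability

variable {β δ : ℝ} {h : ℝ → ℝ}

theorem lineProbability_pos (hβ : 1 < β) (hδ : δ ∈ Set.Ioo (0 : ℝ) 1)
    (h_pos : ∀ x, 0 ≤ x → 0 < h x) {N : ℕ} (hN : 0 < N) (k j : ℕ) :
    0 < lineProbability β δ h N k j := by
  have h1 : 0 < 1 - β⁻¹ := sub_pos.2 (inv_lt_one_of_one_lt₀ hβ)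
  have h2 : 0 < β := by linarith
  have h3 := h_pos j (Nat.cast_nonneg j)
  have h4 := hδ.1
  unfold lineProbability
  positivity

theorem one_le_of_tsum_inv_le_one (h_pos : ∀ x, 0 ≤ x → 0 < h x)
    (h_summable : Summable fun k : ℕ => (h k)⁻¹) (h_sum : ∑' k : ℕ, (h k)⁻¹ ≤ 1) (j : ℕ) :
    1 ≤ h j := by
  have hnn : ∀ k : ℕ, 0 ≤ (h k)⁻¹ := fun k => (inv_pos.2 (h_pos k (Nat.cast_nonneg k))).le
  have := (h_summable.le_tsum j fun k _ => hnn k).trans h_sum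
  rwa [inv_le_one₀ (h_pos j (Nat.cast_nonneg j))] at this

/-- The N directions cancel the factor 1/N, the sum over epochs is at most 1 by the condition on h,
and 1 − β⁻¹ normalizes the geometric series over scales. -/
theorem tsum_lineProbability_le (hβ : 1 < β) (hδ : δ ∈ Set.Ioo (0 : ℝ) 1)
    (h_pos : ∀ x, 0 ≤ x → 0 < h x)
    (h_summable : Summable fun k : ℕ => (h k)⁻¹) (h_sum : ∑' k : ℕ, (h k)⁻¹ ≤ 1)
    {N : ℕ → ℕ} (hN : ∀ k, 0 < N k) :
    ∑' k, (N k : ENNReal) * ∑' j, ENNReal.ofReal (lineProbability β δ h (N k) k j)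
      ≤ ENNReal.ofReal δ := by
  have hβ0 : 0 < β := by linarith
  have hβ1 : β⁻¹ < 1 := inv_lt_one_of_one_lt₀ hβ
  have h1 : 0 < 1 - β⁻¹ := sub_pos.2 hβ1
  have hδ0 := hδ.1
  have hnn : ∀ k : ℕ, 0 ≤ (h k)⁻¹ := fun k => (inv_pos.2 (h_pos k (Nat.cast_nonneg k))).le
  have hk : ∀ k, (N k : ENNReal) * ∑' j, ENNReal.ofReal (lineProbability β δ h (N k) k j)
      ≤ ENNReal.ofReal (δ * (1 - β⁻¹) * (β⁻¹) ^ k) := fun k => by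
    have hNk : (0 : ℝ) < N k := by exact_mod_cast hN k
    have hc : 0 ≤ δ * (1 - β⁻¹) * (β⁻¹) ^ k / N k := by positivity
    unfold lineProbability
    rw [← ENNReal.ofReal_tsum_of_nonneg (fun j => mul_nonneg hc (hnn j)) (h_summable.mul_left _),
      tsum_mul_left, ← ENNReal.ofReal_natCast, ← ENNReal.ofReal_mul hNk.le]
    refine ENNReal.ofReal_le_ofReal ?_
    rw [← mul_assoc, mul_div_cancel₀ _ hNk.ne']
    exact mul_le_of_le_one_right (by positivity) h_sum
  refine (ENNReal.tsum_le_tsum hk).trans_eq ?_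
  rw [← ENNReal.ofReal_tsum_of_nonneg (fun k => by positivity)
    ((summable_geometric_of_lt_one (by positivity) hβ1).mul_left _), tsum_mul_left,
    tsum_geometric_of_lt_one (by positivity) hβ1, mul_inv_cancel_right₀ h1.ne']

theorem log_one_div_lineProbability (hβ : 1 < β) (hδ : δ ∈ Set.Ioo (0 : ℝ) 1)
    (h_pos : ∀ x, 0 ≤ x → 0 < h x) {N : ℕ} (hN : 0 < N) (k j : ℕ) :
    Real.log (1 / lineProbability β δ h N k j)
      = Real.log (h j) + Real.log (1 / δ * (1 / (1 - β⁻¹))) + Real.log (β ^ k * N) := by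
  have h1 : 0 < 1 - β⁻¹ := sub_pos.2 (inv_lt_one_of_one_lt₀ hβ)
  have h2 : 0 < β := by linarith
  have h3 := h_pos j (Nat.cast_nonneg j)
  have h4 := hδ.1
  have h5 : (0 : ℝ) < N := by exact_mod_cast hN
  rw [← Real.log_mul h3.ne' (by positivity), ← Real.log_mul (by positivity) (by positivity)]
  congr 1
  unfold lineProbability
  rw [inv_pow]
  field_simp

/-- Strict positivity, which comes from δ < 1, is what the comparison lemmas for `cgfConjInv`
require of their arguments. -/
theorem log_one_div_lineProbability_pos (hβ : 1 < β) (hδ : δ ∈ Set.Ioo (0 : ℝ) 1)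
    (h_pos : ∀ x, 0 ≤ x → 0 < h x)
    (h_summable : Summable fun k : ℕ => (h k)⁻¹) (h_sum : ∑' k : ℕ, (h k)⁻¹ ≤ 1)
    {N : ℕ} (hN : 0 < N) (k j : ℕ) :
    0 < Real.log (1 / lineProbability β δ h N k j) := by
  have hβ0 : 0 < β := by linarith
  have h1 : 0 < 1 - β⁻¹ := sub_pos.2 (inv_lt_one_of_one_lt₀ hβ)
  have h1' : 1 - β⁻¹ ≤ 1 := sub_le_self _ (inv_pos.2 hβ0).le
  rw [log_one_div_lineProbability hβ hδ h_pos hN]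
  have a1 := Real.log_nonneg (one_le_of_tsum_inv_le_one h_pos h_summable h_sum j)
  have a2 : 0 < Real.log (1 / δ * (1 / (1 - β⁻¹))) :=
    Real.log_pos (one_lt_mul_of_lt_of_le ((one_lt_div hδ.1).2 hδ.2) ((one_le_div h1).2 h1'))
  have hN1 : (1 : ℝ) ≤ N := by exact_mod_cast hN
  have a3 := Real.log_nonneg (one_le_mul_of_one_le_of_one_le (one_le_pow₀ hβ.le (n := k)) hN1)
  linarith

end LineProbability

/-- Simultaneous line bounds over countably many lines and finitely many directions per scale. -/
theorem IsVectorSubPsi.exists_event {Ω : Type*} {m : MeasurableSpace Ω} {μ : Measure Ω}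
    [IsProbabilityMeasure μ] {ℱ : Filtration ℕ m} {d : ℕ} {ψ : ℝ → ℝ} {lmax : EReal}
    {S : ℕ → Ω → EuclideanSpace ℝ (Fin d)} {V : ℕ → Ω → Matrix (Fin d) (Fin d) ℝ}
    (hS : IsVectorSubPsi μ ℱ ψ lmax S V) {K : ℕ → Finset (EuclideanSpace ℝ (Fin d))}
    (hK : ∀ k, ∀ f ∈ K k, ‖f‖ = 1) {l p : ℕ → ℕ → ℝ} (hl : ∀ k j, l k j ∈ cgfDomain lmax)
    (hp : ∀ k j, 0 < p k j) {δ : ℝ} (hδ : 0 ≤ δ)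
    (hsum : ∑' k, ((K k).card : ENNReal) * ∑' j, ENNReal.ofReal (p k j) ≤ ENNReal.ofReal δ) :
    ∃ E : Set Ω, MeasurableSet E ∧ ENNReal.ofReal (1 - δ) ≤ μ E ∧
      ∀ ω ∈ E, ∀ k, ∀ f ∈ K k, ∀ j t,
        l k j * inner ℝ f (S t ω) - ψ (l k j) * inner ℝ f (Matrix.toEuclideanLin (V t ω) f)
          < Real.log (1 / p k j) := by
  set B : Set Ω := ⋃ k, ⋃ f ∈ K k, ⋃ j, {ω | ∃ t, Real.log (1 / p k j) ≤ l k j * inner ℝ f (S t ω)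
    - ψ (l k j) * inner ℝ f (Matrix.toEuclideanLin (V t ω) f)} with hB
  have hμB : μ B ≤ ENNReal.ofReal δ := by
    refine (measure_iUnion_le _).trans (le_trans (ENNReal.tsum_le_tsum fun k => ?_) hsum)
    refine (measure_biUnion_finset_le _ _).trans ?_
    rw [← nsmul_eq_mul]
    refine Finset.sum_le_card_nsmul _ _ _ fun f hf => ?_
    exact (measure_iUnion_le _).trans (ENNReal.tsum_le_tsum fun j =>
      (hS.projection f (hK k f hf)).measure_exists_le (hl k j) (hp k j))
  -- Removing a measurable hull of the bad set avoids proving that `B` is measurable.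
  refine ⟨(toMeasurable μ B)ᶜ, (measurableSet_toMeasurable μ B).compl, ?_, ?_⟩
  · rw [prob_compl_eq_one_sub (measurableSet_toMeasurable μ B), measure_toMeasurable,
      ENNReal.ofReal_sub _ hδ, ENNReal.ofReal_one]
    exact tsub_le_tsub_left hμB 1
  · intro ω hω k f hf j t
    by_contra! hle
    refine hω (subset_toMeasurable μ B ?_)
    simp only [hB, Set.mem_iUnion]
    exact ⟨k, f, hf, j, t, hle⟩

/-! ### The self-normalized bound -/

/-- For `y ≥ 1` and `b > 1` some integer power of `b` lies in `[y, b y]`. -/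
theorem exists_le_pow_le_mul {b y : ℝ} (hb : 1 < b) (hy : 1 ≤ y) :
    ∃ k : ℕ, y ≤ b ^ k ∧ b ^ k ≤ b * y := by
  have hb0 : 0 < b := by linarith
  have hy0 : 0 < y := by linarith
  have hlog : 0 ≤ Real.logb b y := Real.logb_nonneg hb hy
  refine ⟨⌈Real.logb b y⌉₊, ?_, ?_⟩
  · rw [← Real.rpow_natCast, ← Real.logb_le_iff_le_rpow hb hy0]
    exact Nat.le_ceil _
  · rw [← Real.rpow_natCast, ← Real.le_logb_iff_rpow_le hb (by positivity),
      Real.logb_mul hb0.ne' hy0.ne', Real.logb_self_eq_one hb, add_comm]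
    exact (Nat.ceil_lt_add_one hlog).le

/-- Variances are rounded down, since a line taken at level v is usable only at variances w ≥ v;
cover scales are rounded up in `exists_le_pow_le_mul`, since the cover must be fine enough. -/
theorem exists_pow_le_le_mul_pow {b y : ℝ} (hb : 1 < b) (hy : 1 ≤ y) :
    ∃ j : ℕ, b ^ j ≤ y ∧ y ≤ b * b ^ j ∧ (j : ℝ) ≤ Real.logb b y := by
  have hy0 : 0 < y := by linarith
  have hlog : 0 ≤ Real.logb b y := Real.logb_nonneg hb hy
  refine ⟨⌊Real.logb b y⌋₊, ?_, ?_, Nat.floor_le hlog⟩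
  · rw [← Real.rpow_natCast, ← Real.le_logb_iff_rpow_le hb hy0]
    exact Nat.floor_le hlog
  · rw [← pow_succ', ← Real.rpow_natCast, ← Real.logb_le_iff_le_rpow hb hy0]
    exact_mod_cast (Nat.lt_floor_add_one _).le

/-- The comparison is term by term: h is monotone in the epoch, and the covering number decreases in
the radius, where ε/β^k is at least ε/(β√κ). -/
theorem log_one_div_lineProbability_le_logBoundary {d : ℕ} (hd : 1 ≤ d)
    {α β ρ ε δ : ℝ} (hβ : 1 < β)
    (hε : ε ∈ Set.Ioo (0 : ℝ) 1) (hδ : δ ∈ Set.Ioo (0 : ℝ) 1)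
    {h : ℝ → ℝ} (h_mono : MonotoneOn h (Set.Ici 0)) (h_pos : ∀ x, 0 ≤ x → 0 < h x)
    {A : Matrix (Fin d) (Fin d) ℝ} (hA : eigenvalueMax A ρ = A) (hκ : 1 ≤ conditionNumber A)
    {k j : ℕ} (hk : β ^ k ≤ β * √(conditionNumber A))
    (hj : (j : ℝ) ≤ Real.logb α (gammaMax A / ρ)) :
    Real.log (1 / lineProbability β δ h (sphereCoveringNumber d (ε / β ^ k)) k j)
      ≤ logBoundary α β ρ ε δ h A := by
  have hβ0 : 0 < β := by linarith
  have hκ0 : 0 < √(conditionNumber A) := Real.sqrt_pos.2 (by linarith)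
  have hN := sphereCoveringNumber_pos hd (div_pos hε.1 (pow_pos hβ0 k))
  have hj0 : (0 : ℝ) ≤ j := Nat.cast_nonneg j
  have hNle := sphereCoveringNumber_anti d (div_pos hε.1 (mul_pos hβ0 hκ0))
    (div_le_div_of_nonneg_left hε.1.le (pow_pos hβ0 k) hk)
  have hN' : (0 : ℝ) < sphereCoveringNumber d (ε / β ^ k) := by exact_mod_cast hN
  rw [log_one_div_lineProbability hβ hδ h_pos hN, logBoundary, hA]
  gcongr
  · exact h_pos j hj0
  · exact h_mono hj0 (hj0.trans hj) hj

theorem one_le_conditionNumber {d : ℕ} (hd : 1 ≤ d) {A : Matrix (Fin d) (Fin d) ℝ}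
    (hA : A.IsHermitian) (hγ : 0 < gammaMin A) : 1 ≤ conditionNumber A :=
  (one_le_div hγ).2 (gammaMin_le_gammaMax hA hd)

/-- The self-normalized bound for vector-valued sub-`ψ` processes, with the regularized variance
proxy `V + ρ I`. -/
theorem IsVectorSubPsi.exists_event_norm_lt {Ω : Type*} {m : MeasurableSpace Ω} {μ : Measure Ω}
    [IsProbabilityMeasure μ] {ℱ : Filtration ℕ m} {d : ℕ} (hd : 1 ≤ d) {ψ : ℝ → ℝ} {lmax : EReal}
    (hψ : IsCGFLike ψ lmax) (hs : HasUnboundedSlope ψ lmax) (hg : IsSuperGaussian ψ lmax)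
    {S : ℕ → Ω → EuclideanSpace ℝ (Fin d)} {V : ℕ → Ω → Matrix (Fin d) (Fin d) ℝ}
    (hS : IsVectorSubPsi μ ℱ ψ lmax S V)
    {α β ρ ε δ : ℝ} (hα : 1 < α) (hβ : 1 < β) (hρ : 0 < ρ)
    (hε : ε ∈ Set.Ioo (0 : ℝ) 1) (hδ : δ ∈ Set.Ioo (0 : ℝ) 1)
    {h : ℝ → ℝ} (h_mono : MonotoneOn h (Set.Ici 0)) (h_pos : ∀ x, 0 ≤ x → 0 < h x)
    (h_summable : Summable fun k : ℕ => (h k)⁻¹) (h_sum : ∑' k : ℕ, (h k)⁻¹ ≤ 1) :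
    ∃ E : Set Ω, MeasurableSet E ∧ ENNReal.ofReal (1 - δ) ≤ μ E ∧
      ∀ ω ∈ E, ∀ (t : ℕ) (A : Matrix (Fin d) (Fin d) ℝ),
        A = V t ω + ρ • (1 : Matrix (Fin d) (Fin d) ℝ) →
        ∀ p, Matrix.toEuclideanLin (matrixSqrt A) p = S t ω →
          ‖p‖ < √(gammaMin A) / (1 - ε) * cgfConjInv ψ lmax
            (α / gammaMin A * logBoundary α β ρ ε δ h A) := by
  have hα0 : 0 < α := by linarith
  have hβ0 : 0 < β := by linarith
  have hr : ∀ k : ℕ, 0 < ε / β ^ k := fun k => div_pos hε.1 (pow_pos hβ0 k)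
  choose K hK1 hK hcard using fun k => exists_finset_sphere_cover d (hr k)
  have hN : ∀ k, 0 < (K k).card := fun k => by
    rw [hcard]
    exact sphereCoveringNumber_pos hd (hr k)
  set c : ℕ → ℕ → ℝ := fun k j => Real.log (1 / lineProbability β δ h (K k).card k j) with hc
  have hc0 : ∀ k j, 0 < c k j := fun k j =>
    log_one_div_lineProbability_pos hβ hδ h_pos h_summable h_sum (hN k) k j
  have hv : ∀ j : ℕ, 0 < ρ * α ^ j := fun j => by positivity
  have hcv : ∀ k j, 0 < c k j / (ρ * α ^ j) := fun k j => div_pos (hc0 k j) (hv j)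
  -- `l k j` attains the supremum defining the conjugate at u = (ψ*)⁻¹(c/v) with v = ρα^j, so u l −
  -- ψ(l) = c/v, as `IsCGFLike.lt_mul_of_line` needs.
  choose l hl hlu using fun k j => hψ.exists_cgfConj_eq hs (hψ.cgfConjInv_nonneg hs (hcv k j).le)
  obtain ⟨E, hE, hμE, hbound⟩ := hS.exists_event hK1 hl
    (fun k j => lineProbability_pos hβ hδ h_pos (hN k) k j) hδ.1.le
    (tsum_lineProbability_le hβ hδ h_pos h_summable h_sum hN)
  refine ⟨E, hE, hμE, fun ω hω t A hA p hp => ?_⟩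
  have hV := hS.posSemidef t ω
  have hAd : A.PosDef := hA ▸ posDef_add_smul_one hV hρ
  have hργ : ρ ≤ gammaMin A := hA ▸ le_gammaMin_add_smul_one hV hd hρ
  have hAmax : eigenvalueMax A ρ = A := hA ▸ eigenvalueMax_add_smul_one hV hρ
  have hγ : 0 < gammaMin A := hρ.trans_le hργ
  have hκ : 1 ≤ conditionNumber A := one_le_conditionNumber hd hAd.1 hγ
  obtain ⟨k, hk1, hk2⟩ := exists_le_pow_le_mul hβ (Real.one_le_sqrt.2 hκ)
  -- This is √κ(A) ≤ β^k, squared.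
  have hfine : gammaMax A * (ε / β ^ k) ^ 2 ≤ ε ^ 2 * gammaMin A := by
    rw [Real.sqrt_le_left (by positivity), conditionNumber, div_le_iff₀ hγ] at hk1
    rw [div_pow, mul_div_assoc', div_le_iff₀ (by positivity)]
    nlinarith [mul_le_mul_of_nonneg_left hk1 (sq_nonneg ε)]
  obtain ⟨f, hf, hfp⟩ := exists_mem_cover_norm_le hd hAd hγ hε hfine (hK1 k) (hK k) p
  rw [hp] at hfp
  set W := inner ℝ f (Matrix.toEuclideanLin A f) with hW
  have hγW : gammaMin A ≤ W := by
    simpa [hK1 k f hf] using gammaMin_mul_le_inner hAd.1 f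
  have hWΓ : W ≤ gammaMax A := by
    simpa [hK1 k f hf] using inner_le_gammaMax_mul hAd.1 f
  have hW0 : 0 < W := hγ.trans_le hγW
  have hWV : W = inner ℝ f (Matrix.toEuclideanLin (V t ω) f) + ρ := by
    rw [hW, hA, map_add, LinearMap.add_apply, inner_add_right, ← Algebra.algebraMap_eq_smul_one,
      toEuclideanLin_algebraMap, inner_smul_right, real_inner_self_eq_norm_sq, hK1 k f hf]
    simp
  obtain ⟨j, hj1, hj2, hj3⟩ := exists_pow_le_le_mul_pow hα ((one_le_div hρ).2 (hργ.trans hγW))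
  rw [le_div_iff₀ hρ, mul_comm] at hj1
  rw [div_le_iff₀ hρ] at hj2
  have hjΓ : (j : ℝ) ≤ Real.logb α (gammaMax A / ρ) :=
    hj3.trans (Real.logb_le_logb_of_le hα (by positivity) (by gcongr))
  set L := logBoundary α β ρ ε δ h A
  have hcL : c k j ≤ L := by
    simp only [hc, hcard]
    exact log_one_div_lineProbability_le_logBoundary hd hβ hε hδ h_mono h_pos hAmax hκ hk2 hjΓ
  have hL : 0 < L := (hc0 k j).trans_le hcL
  -- Ville's bound concerns V; adding ρ to the variance only lowers the left side because ψ ≥ 0.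
  have hline : l k j * inner ℝ f (S t ω) - ψ (l k j) * W < c k j := by
    have h1 := hbound ω hω k f hf j t
    have h2 := mul_nonneg (hψ.nonneg _ (hl k j)) hρ.le
    rw [hWV]
    linarith
  have hslope := hlu k j
  rw [hψ.cgfConj_cgfConjInv hs (hcv k j).le] at hslope
  have hproj := hψ.lt_mul_of_line (hl k j) (hc0 k j) (hv j) hj1 hslope.symm hline
  -- Rounding the variance to the grid gives W ≤ α · ρα^j, which is where the factor α in the bound
  -- arises.
  have harg : c k j / (ρ * α ^ j) ≤ α * L / W := by
    rw [div_le_div_iff₀ (hv j) hW0]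
    calc c k j * W ≤ L * (α * α ^ j * ρ) := by gcongr
      _ = α * L * (ρ * α ^ j) := by ring
  have hmono := hψ.cgfConjInv_mono hs (hcv k j) harg
  have hanti := hψ.sqrt_mul_cgfConjInv_anti hs hg (mul_pos hα0 hL) hγ hγW
  have hsW : 0 < √W := Real.sqrt_pos.2 hW0
  have hfinal : (1 - ε) * ‖p‖ * √W < √(gammaMin A) * cgfConjInv ψ lmax (α * L / gammaMin A) * √W :=
    calc (1 - ε) * ‖p‖ * √W ≤ inner ℝ f (S t ω) := hfp
      _ < W * cgfConjInv ψ lmax (c k j / (ρ * α ^ j)) := hproj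
      _ ≤ W * cgfConjInv ψ lmax (α * L / W) := by gcongr
      _ = √W * cgfConjInv ψ lmax (α * L / W) * √W := by
        rw [mul_right_comm, Real.mul_self_sqrt hW0.le]
      _ ≤ _ := by gcongr
  have := lt_of_mul_lt_mul_right hfinal hsW.le
  have hε1 : 0 < 1 - ε := sub_pos.2 hε.2
  rw [div_mul_eq_mul_div, lt_div_iff₀ hε1, div_mul_eq_mul_div]
  linarith

/-! ### Ridge regression -/

theorem toEuclideanLin_covarianceProcess {Ω : Type*} {d : ℕ}
    (X : ℕ → Ω → EuclideanSpace ℝ (Fin d)) (t : ℕ) (ω : Ω) (θ : EuclideanSpace ℝ (Fin d)) :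
    Matrix.toEuclideanLin (covarianceProcess X t ω) θ
      = ∑ s ∈ Finset.Icc 1 t, inner ℝ (X s ω) θ • X s ω := by
  rw [covarianceProcess, map_sum, LinearMap.sum_apply]
  refine Finset.sum_congr rfl fun s _ => ?_
  ext i
  simp [Matrix.toLpLin_apply, Matrix.vecMulVec_mulVec, PiLp.inner_apply, dotProduct,
    mul_comm]

theorem designMatrix_transpose_mulVec {Ω : Type*} {d : ℕ}
    (X : ℕ → Ω → EuclideanSpace ℝ (Fin d)) (Y : ℕ → Ω → ℝ) (t : ℕ) (ω : Ω) :
    WithLp.toLp 2 ((designMatrix X t ω).transpose.mulVec (responseVector Y t ω))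
      = ∑ s ∈ Finset.Icc 1 t, Y s ω • X s ω := by
  have hI : Finset.Icc 1 t = Finset.Ico (0 + 1) (t + 1) := by
    ext a
    simp only [Finset.mem_Ico, Finset.mem_Icc]
    omega
  rw [hI, ← Finset.sum_Ico_add', Nat.Ico_zero_eq_range, Finset.sum_range]
  ext i
  simp [designMatrix, responseVector, Matrix.mulVec, dotProduct, mul_comm]

/-- The normal equation of ridge regression in the linear model. -/
theorem IsOnlineLinearRegression.toEuclideanLin_ridgeEstimate_sub {Ω : Type*}
    {m : MeasurableSpace Ω} {μ : Measure Ω} {ℱ : Filtration ℕ m} {d : ℕ} {ψ : ℝ → ℝ}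
    {lmax : EReal} {θ : EuclideanSpace ℝ (Fin d)} {X : ℕ → Ω → EuclideanSpace ℝ (Fin d)}
    {ξ Y : ℕ → Ω → ℝ} (model : IsOnlineLinearRegression μ ℱ ψ lmax θ X ξ Y) {ρ : ℝ} (hρ : 0 < ρ)
    (t : ℕ) (ω : Ω) :
    ridgeEstimate ρ X Y t ω - θ
      = Matrix.toEuclideanLin (covarianceProcess X t ω + ρ • (1 : Matrix (Fin d) (Fin d) ℝ))⁻¹
          (residualProcess X ξ t ω - ρ • θ) := by
  set A := covarianceProcess X t ω + ρ • (1 : Matrix (Fin d) (Fin d) ℝ) with hA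
  have hAd : A.PosDef := posDef_add_smul_one (model.subPsi.posSemidef t ω) hρ
  have hridge : ridgeEstimate ρ X Y t ω
      = Matrix.toEuclideanLin A⁻¹ (∑ s ∈ Finset.Icc 1 t, Y s ω • X s ω) := by
    rw [← designMatrix_transpose_mulVec, Matrix.toLpLin_toLp, ridgeEstimate,
      designMatrix_transpose_mul_self]
    rfl
  have hY : ∑ s ∈ Finset.Icc 1 t, Y s ω • X s ω
      = Matrix.toEuclideanLin (covarianceProcess X t ω) θ + residualProcess X ξ t ω := by
    rw [toEuclideanLin_covarianceProcess, residualProcess, ← Finset.sum_add_distrib]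
    refine Finset.sum_congr rfl fun s hs => ?_
    rw [model.response s (Finset.mem_Icc.1 hs).1 ω, add_smul]
  have hAθ : Matrix.toEuclideanLin A θ
      = Matrix.toEuclideanLin (covarianceProcess X t ω) θ + ρ • θ := by
    rw [hA, map_add, LinearMap.add_apply, ← Algebra.algebraMap_eq_smul_one,
      toEuclideanLin_algebraMap]
  rw [hridge, hY, sub_eq_iff_eq_add]
  have hθ := toEuclideanLin_inv_mul hAd θ
  rw [hAθ] at hθ
  -- Only the free-standing `θ` is replaced, by A⁻¹(Vθ + ρθ), so that both sides are images under
  -- A⁻¹.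
  nth_rw 3 [← hθ]
  rw [← map_add]
  congr 1
  abel

/-- The vector inside the norm is q = A^{-1/2} x, so ‖x‖² = ⟨q, A q⟩ ≥ ρ‖q‖². With x = θ this is the
bias of the ridge estimate. -/
theorem norm_matrixSqrt_inv_le {d : ℕ} {A : Matrix (Fin d) (Fin d) ℝ} (hA : A.PosDef) {ρ : ℝ}
    (hρ : 0 < ρ) (hργ : ρ ≤ gammaMin A) (x : EuclideanSpace ℝ (Fin d)) :
    ρ * ‖Matrix.toEuclideanLin (matrixSqrt A) (Matrix.toEuclideanLin A⁻¹ x)‖ ≤ √ρ * ‖x‖ := by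
  set q := Matrix.toEuclideanLin (matrixSqrt A) (Matrix.toEuclideanLin A⁻¹ x)
  have hq : Matrix.toEuclideanLin (matrixSqrt A) q = x := by
    rw [← toEuclideanLin_mul_apply, matrixSqrt_mul_self hA.posSemidef, toEuclideanLin_mul_inv hA]
  have h1 : ρ * ‖q‖ ^ 2 ≤ ‖x‖ ^ 2 := by
    have := gammaMin_mul_le_inner hA.1 q
    rw [← norm_matrixSqrt_sq hA.posSemidef, hq] at this
    exact (mul_le_mul_of_nonneg_right hργ (sq_nonneg _)).trans this
  have h2 : √ρ * ‖q‖ ≤ ‖x‖ := by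
    refine le_of_sq_le_sq ?_ (norm_nonneg x)
    rwa [mul_pow, Real.sq_sqrt hρ.le]
  calc ρ * ‖q‖ = √ρ * (√ρ * ‖q‖) := by rw [← mul_assoc, Real.mul_self_sqrt hρ.le]
    _ ≤ _ := by gcongr

theorem corollary5p2 {Ω : Type*} {m : MeasurableSpace Ω} (μ : Measure Ω) [IsProbabilityMeasure μ]
    (ℱ : Filtration ℕ m) {d : ℕ} (hd : 1 ≤ d)
    (ψ : ℝ → ℝ) (lmax : EReal) (hψ : HasUnboundedSlope ψ lmax)
    (θ : EuclideanSpace ℝ (Fin d)) (X : ℕ → Ω → EuclideanSpace ℝ (Fin d)) (ξ Y : ℕ → Ω → ℝ)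
    (model : IsOnlineLinearRegression μ ℱ ψ lmax θ X ξ Y)
    (α β ρ ε δ : ℝ) (hα : 1 < α) (hβ : 1 < β) (hρ : 0 < ρ)
    (hε : ε ∈ Set.Ioo (0 : ℝ) 1) (hδ : δ ∈ Set.Ioo (0 : ℝ) 1)
    (h : ℝ → ℝ) (h_mono : MonotoneOn h (Set.Ici 0)) (h_pos : ∀ x, 0 ≤ x → 0 < h x)
    (h_summable : Summable fun k : ℕ => (h k)⁻¹) (h_sum : ∑' k : ℕ, (h k)⁻¹ ≤ 1) :
    -- there is an event of probability at least `1 - δ` on which the bound holds for all `t ≥ 1`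
    ∃ E : Set Ω, MeasurableSet E ∧ ENNReal.ofReal (1 - δ) ≤ μ E ∧
      ∀ ω ∈ E, ∀ t : ℕ, 1 ≤ t →
        ‖Matrix.toEuclideanLin
            (matrixSqrt (covarianceProcess X t ω + ρ • (1 : Matrix (Fin d) (Fin d) ℝ)))
            (ridgeEstimate ρ X Y t ω - θ)‖
          < √(gammaMin (covarianceProcess X t ω + ρ • (1 : Matrix (Fin d) (Fin d) ℝ))) / (1 - ε)
              * cgfConjInv ψ lmax
                (α / gammaMin (covarianceProcess X t ω + ρ • (1 : Matrix (Fin d) (Fin d) ℝ))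
                  * logBoundary α β ρ ε δ h
                      (covarianceProcess X t ω + ρ • (1 : Matrix (Fin d) (Fin d) ℝ)))
            + √ρ * ‖θ‖ := by
  obtain ⟨E, hE, hμE, hbound⟩ := model.subPsi.exists_event_norm_lt hd model.cgfLike hψ
    model.superGaussian hα hβ hρ hε hδ h_mono h_pos h_summable h_sum
  refine ⟨E, hE, hμE, fun ω hω t _ => ?_⟩
  have hV := model.subPsi.posSemidef t ω
  have hridge := model.toEuclideanLin_ridgeEstimate_sub hρ t ω
  set A := covarianceProcess X t ω + ρ • (1 : Matrix (Fin d) (Fin d) ℝ) with hA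
  have hAd : A.PosDef := posDef_add_smul_one hV hρ
  -- The vector p = A^{-1/2} S_t is written as A^{1/2} A⁻¹ S_t, the form in which it appears after
  -- the normal equation.
  have hnoise := hbound ω hω t A hA
    (Matrix.toEuclideanLin (matrixSqrt A) (Matrix.toEuclideanLin A⁻¹ (residualProcess X ξ t ω))) (by
      rw [← toEuclideanLin_mul_apply, matrixSqrt_mul_self hAd.posSemidef,
        toEuclideanLin_mul_inv hAd])
  have hbias := norm_matrixSqrt_inv_le hAd hρ (le_gammaMin_add_smul_one hV hd hρ) θ
  rw [hridge, map_sub, map_sub, map_smul, map_smul]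
  refine (norm_sub_le _ _).trans_lt ?_
  rw [norm_smul, Real.norm_of_nonneg hρ.le]
  exact add_lt_add_of_lt_of_le hnoise hbias
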